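/- **Theorem C.** Let $(G,\tau)$ be a precompact abelian group, i.e. an abelian group with a Hausdorff, totally bounded group topology. Say that a precompact abelian group $(X,\sigma)$ is *ss-characterized* if there is a sequence $(u_n)$ in $X$ such that $\sigma$ is the finest among all precompact (Hausdorff, totally bounded) group topologies on $X$ in which $u_n\to 0$; and that a subgroup $H$ of $G$ is *$B$-embedded* if every (algebraic) homomorphism $\chi\colon G/H\to\mathbb{T}=\mathbb{R}/\mathbb{Z}$ is continuous in the quotient topology of $G/H$. Then the following are equivalent: (i) $(G,\tau)$ is ss-characterized; (ii) $(G,\tau)$ has a countable (possibly finite) $B$-embedded subgroup $H$ such that $H$, with the subspace topology $\tau|_H$, is ss-characterized. -/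

import Mathlib

open Filter Topology
open scoped Pointwise

/-- A topology `τ` on an abelian group `G` is a *precompact group topology* if it is a Hausdorff
group topology which is totally bounded: finitely many translates of any neighbourhood of `0`
cover `G`. -/
structure IsPrecompactGroupTopology {G : Type*} [AddCommGroup G] (τ : TopologicalSpace G) :
    Prop where
  isTopologicalAddGroup : IsTopologicalAddGroup G
  t2Space : T2Space G
  exists_finite_add_eq_univ :
    ∀ U ∈ 𝓝 (0 : G), ∃ F : Set G, F.Finite ∧ F + U = Set.univ

/-- The sequence `u` converges to `0` in the topology `τ`. -/
def TendsToZero {G : Type*} [AddCommGroup G] (τ : TopologicalSpace G) (u : ℕ → G) : Prop :=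
  Tendsto u atTop (𝓝 0)

/-- The sequence `u` *characterizes* `τ`: `τ` is the finest among all precompact group topologies
on `G` in which `u` converges to `0`. (In the order on `TopologicalSpace G`, `σ ≤ σ'` means that
`σ` is finer than `σ'`, so the finest topology is the least one.) -/
def Characterizes {G : Type*} [AddCommGroup G] (u : ℕ → G) (τ : TopologicalSpace G) : Prop :=
  IsLeast {σ : TopologicalSpace G | IsPrecompactGroupTopology σ ∧ TendsToZero σ u} τ

/-- `τ` is *single sequence characterized*. -/
def IsSSCharacterized {G : Type*} [AddCommGroup G] (τ : TopologicalSpace G) : Prop :=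
  ∃ u : ℕ → G, Characterizes u τ

/-- A subgroup `H` of a topological abelian group `G` is *B-embedded* if every (algebraic)
character of `G ⧸ H` is continuous in the quotient topology. -/
def IsBEmbedded {G : Type*} [AddCommGroup G] [TopologicalSpace G] (H : AddSubgroup G) : Prop :=
  ∀ χ : G ⧸ H →+ UnitAddCircle, Continuous χ

/-! Continuous characters decide everything. A precompact topology is the weak topology of its
continuous characters: its completion is compact, and Peter–Weyl, proved here with compact
convolution operators, separates points there. If `u` characterizes `τ`, every character tending to
0 along `u` is `τ`-continuous, since adjoining it to `τ` yields another precompact topology in which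
`u` tends to 0. Let `H` be generated by `u`. Characters of `G ⧸ H` kill `u`, so `H` is B-embedded; a
character of `H` continuous for a competing topology extends to `G` and tends to 0 along `u`, hence
is `τ`-continuous. Conversely, let `u` characterize `τ` on `H` and let `σ` be a competitor on `G`.
Then `τ ⊓ σ` agrees with `τ` on `H` by the choice of `u`, and on `G ⧸ H` because all characters
there are `τ`-continuous. Merson's lemma gives `τ ≤ τ ⊓ σ ≤ σ`. -/

section InnerKernel

variable {X E : Type*} [TopologicalSpace X] [CompactSpace X] [NormedAddCommGroup E]
  [InnerProductSpace ℂ E]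

/-- The operator sending `f` to the continuous function `x ↦ ⟪φ x, f⟫`. -/
noncomputable def innerKernelOperator (φ : C(X, E)) : E →L[ℂ] C(X, ℂ) :=
  LinearMap.mkContinuous
    { toFun := fun f => ⟨fun x => inner ℂ (φ x) f, by fun_prop⟩
      map_add' := fun f g => by ext x; simp
      map_smul' := fun c f => by ext x; simp }
    ‖φ‖ (fun f => by
      refine (ContinuousMap.norm_le _ (by positivity)).2 fun x => ?_
      exact (norm_inner_le_norm _ _).trans
        (mul_le_mul_of_nonneg_right (φ.norm_coe_le_norm x) (norm_nonneg _)))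

/-- Arzelà–Ascoli: on the unit ball the values are bounded by `‖φ‖`, and `‖φ x - φ y‖` is a common
modulus of continuity at `x`. -/
theorem isCompactOperator_innerKernelOperator (φ : C(X, E)) :
    IsCompactOperator (innerKernelOperator φ) := by
  have key : IsCompactOperator fun f : E =>
      ContinuousMap.linearIsometryBoundedOfCompact X ℂ ℂ (innerKernelOperator φ f) := by
    change IsCompactOperator
      (((ContinuousMap.linearIsometryBoundedOfCompact X ℂ ℂ).toContinuousLinearEquiv :
        C(X, ℂ) →L[ℂ] BoundedContinuousFunction X ℂ).comp (innerKernelOperator φ)).toLinearMap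
    rw [isCompactOperator_iff_isCompact_closure_image_closedBall _ one_pos]
    refine BoundedContinuousFunction.arzela_ascoli (Metric.closedBall 0 ‖φ‖)
      (isCompact_closedBall _ _) _ ?_ ?_
    · rintro _ x ⟨f, hf, rfl⟩
      rw [mem_closedBall_zero_iff] at hf ⊢
      change ‖inner ℂ (φ x) f‖ ≤ _
      calc _ ≤ ‖φ x‖ * ‖f‖ := norm_inner_le_norm _ _
        _ ≤ ‖φ‖ * 1 := by
          gcongr
          exact φ.norm_coe_le_norm x
        _ = _ := mul_one _
    · intro x
      refine Metric.equicontinuousAt_of_continuity_modulus (fun y => ‖φ x - φ y‖) ?_ _ ?_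
      · have : Continuous fun y => ‖φ x - φ y‖ := by fun_prop
        simpa using this.tendsto x
      · refine Eventually.of_forall fun y => ?_
        rintro ⟨_, f, hf, rfl⟩
        rw [mem_closedBall_zero_iff] at hf
        change dist (inner ℂ (φ x) f) (inner ℂ (φ y) f) ≤ _
        rw [dist_eq_norm, ← inner_sub_left]
        calc _ ≤ ‖φ x - φ y‖ * ‖f‖ := norm_inner_le_norm _ _
          _ ≤ ‖φ x - φ y‖ * 1 := by gcongr
          _ = _ := mul_one _
  have h := key.continuous_comp
    (ContinuousMap.linearIsometryBoundedOfCompact X ℂ ℂ).symm.continuous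
  simpa [Function.comp_def] using h

end InnerKernel

/-! ### Common eigenvectors -/

/-- A commuting family of endomorphisms of a nontrivial finite-dimensional complex vector space
has a common eigenvector. -/
theorem exists_common_eigenvector {ι V : Type*} [AddCommGroup V] [Module ℂ V]
    [FiniteDimensional ℂ V] [Nontrivial V] (F : ι → Module.End ℂ V)
    (hF : ∀ i j, Commute (F i) (F j)) :
    ∃ v : V, v ≠ 0 ∧ ∃ c : ι → ℂ, ∀ i, F i v = c i • v := by
  -- On a minimal nonzero invariant subspace each `F i` is scalar: otherwise an eigenspace cuts out
  -- a smaller one, invariant by commutativity.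
  obtain ⟨M, ⟨hM, hFM⟩, hmin⟩ := WellFounded.has_min (wellFounded_lt (α := Submodule ℂ V))
    {M | M ≠ ⊥ ∧ ∀ i, ∀ v ∈ M, F i v ∈ M} ⟨⊤, top_ne_bot, fun _ _ _ => Submodule.mem_top⟩
  obtain ⟨v, hvM, hv⟩ := (Submodule.ne_bot_iff M).1 hM
  have : ∀ i, ∃ c : ℂ, ∀ w ∈ M, F i w = c • w := by
    intro i
    have : Nontrivial M := Submodule.nontrivial_iff_ne_bot.2 hM
    obtain ⟨c, hc⟩ := Module.End.exists_eigenvalue ((F i).restrict (hFM i))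
    obtain ⟨w, hw⟩ := hc.exists_hasEigenvector
    refine ⟨c, ?_⟩
    by_contra hne
    push Not at hne
    obtain ⟨w', hw'M, hw'⟩ := hne
    refine hmin (M ⊓ Module.End.eigenspace (F i) c) ⟨?_, ?_⟩
      (lt_of_le_of_ne inf_le_left fun h => ?_)
    · refine (Submodule.ne_bot_iff _).2 ⟨w, ⟨w.2, ?_⟩, by simpa using hw.2⟩
      exact Module.End.mem_eigenspace_iff.2 (congrArg Subtype.val hw.apply_eq_smul)
    · rintro j y ⟨hyM, hy⟩
      refine ⟨hFM j y hyM, Module.End.mem_eigenspace_iff.2 ?_⟩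
      rw [← Module.End.mul_apply, (hF i j).eq, Module.End.mul_apply,
        Module.End.mem_eigenspace_iff.1 hy, map_smul]
    · rw [← h] at hw'M
      exact hw' (Module.End.mem_eigenspace_iff.1 hw'M.2)
  choose c hc using this
  exact ⟨v, hv, c, fun i => hc i v hvM⟩

/-- Let a compact symmetric operator `T ≠ 0` on a Hilbert space `E` factor as `L ∘ A` through an
injective linear map `L : V → E`. Any commuting family of endomorphisms of `V` commuting with
`A ∘ L` has a common eigenvector that is an eigenvector of `A ∘ L` with nonzero eigenvalue. -/
theorem exists_common_eigenvector_of_isCompactOperator {ι V E : Type*} [AddCommGroup V]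
    [Module ℂ V] [NormedAddCommGroup E] [InnerProductSpace ℂ E] [CompleteSpace E]
    {T : E →L[ℂ] E} (hTc : IsCompactOperator T) (hTs : T.IsSymmetric) (hT0 : T ≠ 0)
    (L : V →ₗ[ℂ] E) (hL : Function.Injective L) (A : E →ₗ[ℂ] V) (hT : ∀ f, T f = L (A f))
    (F : ι → Module.End ℂ V) (hF : ∀ i j, Commute (F i) (F j))
    (hFA : ∀ i v, A (L (F i v)) = F i (A (L v))) :
    ∃ v : V, v ≠ 0 ∧ (∃ c : ι → ℂ, ∀ i, F i v = c i • v) ∧ ∃ r : ℂ, r ≠ 0 ∧ A (L v) = r • v := by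
  have := (ContinuousLinearMap.eq_zero_of_forall_hasEigenvalue_eq_zero hTc hTs).not.2 hT0
  push Not at this
  obtain ⟨r, hr, hr0⟩ := this
  have hfin := ContinuousLinearMap.finite_dimensional_eigenspace hTc r hr0
  -- The eigenspace is pulled back to `V`, where the family acts; compactness of `T` makes it
  -- finite-dimensional.
  let W : Submodule ℂ V := (Module.End.eigenspace T.toLinearMap r).comap L
  have hW : ∀ g, g ∈ W ↔ A (L g) = r • g := by
    intro g
    rw [Submodule.mem_comap, Module.End.mem_eigenspace_iff, ← map_smul]
    change T (L g) = _ ↔ _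
    rw [hT]
    exact hL.eq_iff
  have : FiniteDimensional ℂ W := by
    refine FiniteDimensional.of_injective
      (L.restrict (p := W) (q := Module.End.eigenspace T.toLinearMap r) fun _ h => h) ?_
    intro a b hab
    exact Subtype.ext (hL (congrArg Subtype.val hab))
  have : Nontrivial W := by
    obtain ⟨v, hv⟩ := hr.exists_hasEigenvector
    rw [Submodule.nontrivial_iff_ne_bot, Submodule.ne_bot_iff]
    have hTv : L (A v) = r • v := (hT v).symm.trans hv.apply_eq_smul
    refine ⟨A v, ?_, fun h => ?_⟩
    · rw [hW, hTv, map_smul]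
    · rw [h, map_zero] at hTv
      exact smul_ne_zero hr0 hv.2 hTv.symm
  have hinv : ∀ i, ∀ g ∈ W, F i g ∈ W := by
    intro i g hg
    rw [hW] at hg ⊢
    rw [hFA, hg, map_smul]
  obtain ⟨g, hg, c, hc⟩ := exists_common_eigenvector (fun i => (F i).restrict (hinv i))
    (fun i j => LinearMap.ext fun g =>
      Subtype.ext (congrArg (fun f : Module.End ℂ V => f g) (hF i j).eq))
  exact ⟨g, by simpa using hg, ⟨c, fun i => congrArg Subtype.val (hc i)⟩, r, hr0, (hW _).1 g.2⟩

/-! ### Translations and convolution on a compact group -/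

section Translation

variable {K : Type*} [AddCommGroup K] [TopologicalSpace K] [IsTopologicalAddGroup K]

/-- Translation of continuous functions. -/
noncomputable def translateLinear (y : K) : C(K, ℂ) →ₗ[ℂ] C(K, ℂ) where
  toFun g := g.comp ⟨fun z => z + y, by fun_prop⟩
  map_add' _ _ := rfl
  map_smul' _ _ := rfl

@[simp]
theorem translateLinear_apply (y : K) (g : C(K, ℂ)) (z : K) :
    translateLinear y g z = g (z + y) := rfl

end Translation

section Convolution

open MeasureTheory Measure ComplexConjugate

variable {K : Type*} [AddCommGroup K] [TopologicalSpace K] [IsTopologicalAddGroup K]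
  [CompactSpace K] [T2Space K] [MeasurableSpace K] [BorelSpace K]

/-- The continuous family of square-integrable functions `z ↦ k (x - z)`. -/
noncomputable def reflectedTranslates (k : C(K, ℝ)) : C(K, Lp ℂ 2 (addHaar : Measure K)) :=
  (⟨ContinuousMap.toLp 2 addHaar ℂ, (ContinuousMap.toLp 2 addHaar ℂ).continuous⟩ :
    C(C(K, ℂ), Lp ℂ 2 (addHaar : Measure K))).comp
    (ContinuousMap.curry ⟨fun p : K × K => (k (p.1 - p.2) : ℂ), by fun_prop⟩)

/-- Convolution with `k`, from square-integrable functions to continuous functions. -/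
noncomputable def convOperator (k : C(K, ℝ)) : Lp ℂ 2 (addHaar : Measure K) →L[ℂ] C(K, ℂ) :=
  innerKernelOperator (reflectedTranslates k)

theorem convOperator_toLp_apply (k : C(K, ℝ)) (g : C(K, ℂ)) (x : K) :
    convOperator k (ContinuousMap.toLp 2 addHaar ℂ g) x =
      ∫ z, g z * (k (x - z) : ℂ) ∂(addHaar : Measure K) := by
  change inner ℂ (ContinuousMap.toLp 2 addHaar ℂ
    (⟨fun z => (k (x - z) : ℂ), by fun_prop⟩ : C(K, ℂ))) _ = _
  rw [ContinuousMap.inner_toLp]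
  simp

/-- Convolution with `k` as an operator on square-integrable functions. -/
noncomputable def convEnd (k : C(K, ℝ)) :
    Lp ℂ 2 (addHaar : Measure K) →L[ℂ] Lp ℂ 2 (addHaar : Measure K) :=
  (ContinuousMap.toLp 2 addHaar ℂ).comp (convOperator k)

theorem convEnd_apply (k : C(K, ℝ)) (f : Lp ℂ 2 (addHaar : Measure K)) :
    convEnd k f = ContinuousMap.toLp 2 addHaar ℂ (convOperator k f) := rfl

theorem isCompactOperator_convEnd (k : C(K, ℝ)) : IsCompactOperator (convEnd k) :=
  (isCompactOperator_innerKernelOperator (reflectedTranslates k)).continuous_comp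
    (ContinuousMap.toLp 2 (addHaar : Measure K) ℂ).continuous

theorem isSymmetric_convEnd (k : C(K, ℝ)) (hk : ∀ x, k (-x) = k x) :
    (convEnd k).IsSymmetric := by
  have hd : DenseRange (ContinuousMap.toLp 2 addHaar ℂ : C(K, ℂ) →L[ℂ] Lp ℂ 2 addHaar) :=
    ContinuousMap.toLp_denseRange ℂ addHaar ℂ (by simp)
  intro f g
  refine hd.induction_on₂ (p := fun f g =>
    inner ℂ (convEnd k f) g = inner ℂ f (convEnd k g)) ?_ ?_ f g
  · exact isClosed_eq (by fun_prop) (by fun_prop)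
  · intro a b
    rw [convEnd_apply, convEnd_apply, ContinuousMap.inner_toLp, ContinuousMap.inner_toLp]
    simp only [convOperator_toLp_apply, ← integral_conj, ← integral_const_mul,
      ← integral_mul_const]
    rw [integral_integral_swap_of_hasCompactSupport]
    · refine integral_congr_ae (Eventually.of_forall fun x => ?_)
      refine integral_congr_ae (Eventually.of_forall fun z => ?_)
      simp only [map_mul, Complex.conj_ofReal]
      rw [← hk (x - z), neg_sub]
      ring
    · simp only [Function.uncurry_def]
      fun_prop
    · exact HasCompactSupport.of_compactSpace _

theorem convOperator_translateLinear (k : C(K, ℝ)) (g : C(K, ℂ)) (y : K) :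
    convOperator k (ContinuousMap.toLp 2 addHaar ℂ (translateLinear y g)) =
      translateLinear y (convOperator k (ContinuousMap.toLp 2 addHaar ℂ g)) := by
  ext x
  rw [translateLinear_apply, convOperator_toLp_apply, convOperator_toLp_apply,
    ← integral_add_right_eq_self (fun z => g z * (k (x + y - z) : ℂ)) y]
  simp

theorem convEnd_ne_zero (k : C(K, ℝ)) (hk : ∀ x, k (-x) = k x) (hk0 : k ≠ 0) :
    convEnd k ≠ 0 := by
  have hinj : Function.Injective (ContinuousMap.toLp 2 addHaar ℂ : C(K, ℂ) →L[ℂ] Lp ℂ 2 addHaar) :=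
    ContinuousMap.toLp_injective addHaar
  intro h
  refine hk0 ?_
  let k' : C(K, ℂ) := ⟨fun z => (k z : ℂ), by fun_prop⟩
  have h1 : convEnd k (ContinuousMap.toLp 2 addHaar ℂ k') = ContinuousMap.toLp 2 addHaar ℂ 0 := by
    rw [h, map_zero]; rfl
  have h2 := congrArg (fun g : C(K, ℂ) => g 0) (hinj h1)
  change inner ℂ (ContinuousMap.toLp 2 addHaar ℂ
    (⟨fun z => (k (0 - z) : ℂ), by fun_prop⟩ : C(K, ℂ))) _ = 0 at h2
  have h3 : (⟨fun z => (k (0 - z) : ℂ), by fun_prop⟩ : C(K, ℂ)) = k' := by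
    ext z; simp [k', hk]
  rw [h3, inner_self_eq_zero, ← map_zero (ContinuousMap.toLp 2 addHaar ℂ)] at h2
  ext z
  have := congrArg (fun g : C(K, ℂ) => g z) (hinj h2)
  simpa [k'] using this

/-- An even nonzero continuous kernel on a compact abelian group has a translation eigenvector
which is an eigenvector of convolution with a nonzero eigenvalue. -/
theorem exists_eigenvector_convOperator (k : C(K, ℝ)) (hk : ∀ x, k (-x) = k x) (hk0 : k ≠ 0) :
    ∃ g : C(K, ℂ), g ≠ 0 ∧ (∃ c : K → ℂ, ∀ y, translateLinear y g = c y • g) ∧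
      ∃ r : ℂ, r ≠ 0 ∧ convOperator k (ContinuousMap.toLp 2 addHaar ℂ g) = r • g :=
  exists_common_eigenvector_of_isCompactOperator (isCompactOperator_convEnd k)
    (isSymmetric_convEnd k hk) (convEnd_ne_zero k hk hk0)
    (ContinuousMap.toLp 2 addHaar ℂ).toLinearMap (ContinuousMap.toLp_injective addHaar)
    (convOperator k).toLinearMap (convEnd_apply k) translateLinear
    (fun y y' => by
      refine LinearMap.ext fun g => ContinuousMap.ext fun z => ?_
      simp only [Module.End.mul_apply, translateLinear_apply]
      rw [add_right_comm])
    (fun y g => convOperator_translateLinear k g y)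

end Convolution

/-! ### Peter–Weyl for compact abelian groups -/

/-- A continuous nowhere vanishing multiplicative complex function on a compact group is induced by
a continuous character with values in `UnitAddCircle`. -/
theorem exists_character_of_multiplicative {K : Type*} [AddCommGroup K] [TopologicalSpace K]
    [CompactSpace K] (c : K → ℂ) (hc : Continuous c) (h0 : c 0 = 1)
    (hadd : ∀ x y, c (x + y) = c x * c y) :
    ∃ χ : K →+ UnitAddCircle, Continuous χ ∧ ∀ x, χ x = 0 → c x = 1 := by
  have hnsmul : ∀ (n : ℕ) x, c (n • x) = c x ^ n := by
    intro n x
    induction n with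
    | zero => simp [h0]
    | succ n ih => rw [succ_nsmul, hadd, ih, pow_succ]
  obtain ⟨C, hC⟩ := (isCompact_range hc).isBounded.exists_norm_le
  have hle : ∀ x, ‖c x‖ ≤ 1 := by
    intro x
    by_contra! h
    obtain ⟨n, hn⟩ := pow_unbounded_of_one_lt C h
    have := hC _ ⟨n • x, rfl⟩
    rw [hnsmul, norm_pow] at this
    linarith
  have hnorm : ∀ x, ‖c x‖ = 1 := by
    intro x
    refine le_antisymm (hle x) ?_
    have h1 : ‖c x‖ * ‖c (-x)‖ = 1 := by
      rw [← norm_mul, ← hadd, add_neg_cancel, h0, norm_one]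
    calc (1 : ℝ) = ‖c x‖ * ‖c (-x)‖ := h1.symm
      _ ≤ ‖c x‖ * 1 := by gcongr; exact hle _
      _ = _ := mul_one _
  let d : K → Circle := fun x => ⟨c x, mem_sphere_zero_iff_norm.2 (hnorm x)⟩
  have hd : Continuous d := hc.subtype_mk _
  let e := AddCircle.homeomorphCircle (T := 1) one_ne_zero
  have he : ∀ x, AddCircle.toCircle (e.symm (d x)) = d x := by
    intro x
    rw [← AddCircle.homeomorphCircle_apply one_ne_zero]
    exact e.apply_symm_apply _
  refine ⟨AddMonoidHom.mk' (fun x => e.symm (d x)) fun x y => ?_, ?_, fun x hx => ?_⟩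
  · refine AddCircle.injective_toCircle one_ne_zero ?_
    rw [AddCircle.toCircle_add, he, he, he]
    exact Subtype.ext (hadd x y)
  · exact e.symm.continuous.comp hd
  · have h1 := he x
    change e.symm (d x) = 0 at hx
    rw [hx, AddCircle.toCircle_zero] at h1
    exact (congrArg Subtype.val h1).symm

/-- **Peter–Weyl** for compact abelian groups: continuous characters separate points. -/
theorem exists_continuous_character_ne_zero {K : Type*} [AddCommGroup K] [TopologicalSpace K]
    [IsTopologicalAddGroup K] [CompactSpace K] [T2Space K] {x : K} (hx : x ≠ 0) :
    ∃ χ : K →+ UnitAddCircle, Continuous χ ∧ χ x ≠ 0 := by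
  borelize K
  obtain ⟨f, hf0, hf1, -⟩ := exists_continuous_zero_one_of_isClosed
    (s := {x, -x}) (t := ({0} : Set K)) (Set.toFinite _).isClosed isClosed_singleton
    (by simp [hx, hx.symm])
  let h : C(K, ℝ) := ⟨fun y => f y + f (-y), by fun_prop⟩
  have hfx : f x = 0 := hf0 (by simp)
  have hfx' : f (-x) = 0 := hf0 (by simp)
  have hf1' : f 0 = 1 := hf1 rfl
  -- A second difference of `h` in direction `x`: convolution with it annihilates `x`-periodic
  -- functions, yet `k 0 = 4`.
  let k : C(K, ℝ) := ⟨fun y => 2 * h y - (h (y + x) + h (y - x)), by fun_prop⟩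
  obtain ⟨g, hg, ⟨c, hc⟩, r, hr, hgr⟩ := exists_eigenvector_convOperator k
    (fun y => by
      have e1 : -(-y + x) = y - x := by abel
      have e2 : -(-y - x) = y + x := by abel
      have e3 : -(y + x) = -y - x := by abel
      have e4 : -(y - x) = -y + x := by abel
      simp only [k, h, ContinuousMap.coe_mk, e1, e2, e3, e4, neg_neg]
      ring)
    (fun hk => by
      have := congrArg (fun k : C(K, ℝ) => k 0) hk
      simp [k, h, hfx, hfx', hf1'] at this)
  have hcg : ∀ y z, g (z + y) = c y * g z := fun y z => by
    simpa using congrArg (fun g : C(K, ℂ) => g z) (hc y)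
  obtain ⟨z, hz⟩ : ∃ z, g z ≠ 0 := by
    by_contra! h
    exact hg (ContinuousMap.ext h)
  have hceq : ∀ y, c y = g (z + y) / g z := fun y => by rw [hcg, mul_div_cancel_right₀ _ hz]
  have hccont : Continuous c := by
    rw [funext hceq]
    fun_prop
  obtain ⟨χ, hχ, hχc⟩ := exists_character_of_multiplicative c hccont
    (by rw [hceq, add_zero, div_self hz])
    (fun a b => by
      refine mul_right_cancel₀ hz ?_
      rw [← hcg, add_comm a b, ← add_assoc, hcg, hcg, mul_assoc])
  -- If `χ x = 0`, then `g` is `x`-periodic, so its convolution with `k` vanishes, against the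
  -- nonzero eigenvalue.
  refine ⟨χ, hχ, fun hχx => hg ?_⟩
  have hcx := hχc x hχx
  have hper : ∀ w, g (w + x) = g w := fun w => by rw [hcg, hcx, one_mul]
  have hper' : ∀ w, g (w - x) = g w := fun w => by rw [← hper, sub_add_cancel]
  suffices convOperator k (ContinuousMap.toLp 2 MeasureTheory.Measure.addHaar ℂ g) = 0 by
    rw [this] at hgr
    exact (smul_eq_zero.1 hgr.symm).resolve_left hr
  ext w
  rw [convOperator_toLp_apply]
  have hint : ∀ F : K → ℂ, Continuous F →
      MeasureTheory.Integrable F (MeasureTheory.Measure.addHaar : MeasureTheory.Measure K) :=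
    fun F hF => hF.integrable_of_hasCompactSupport (HasCompactSupport.of_compactSpace _)
  have h1 := MeasureTheory.integral_add_right_eq_self
    (μ := MeasureTheory.Measure.addHaar) (fun z => g z * (h (w - z) : ℂ)) x
  have h2 := MeasureTheory.integral_sub_right_eq_self
    (μ := MeasureTheory.Measure.addHaar) (fun z => g z * (h (w - z) : ℂ)) x
  have e1 : ∀ z, w - (z + x) = w - z - x := fun z => by abel
  have e2 : ∀ z, w - (z - x) = w - z + x := fun z => by abel
  simp only [hper, e1] at h1
  simp only [hper', e2] at h2
  calc _ = ∫ z, (2 * (g z * (h (w - z) : ℂ)) -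
        (g z * (h (w - z + x) : ℂ) + g z * (h (w - z - x) : ℂ)))
          ∂(MeasureTheory.Measure.addHaar : MeasureTheory.Measure K) := by
        congr 1 with z
        simp only [k, ContinuousMap.coe_mk]
        push_cast
        ring
    _ = 0 := by
        rw [MeasureTheory.integral_sub, MeasureTheory.integral_add,
          MeasureTheory.integral_const_mul, h1, h2]
        · ring
        all_goals exact hint _ (by fun_prop)

/-! ### Algebraic characters -/

/-- Characters extend from subgroups of abelian groups. -/
theorem exists_character_extension {A B : Type*} [AddCommGroup A] [AddCommGroup B] (f : A →+ B)
    (hf : Function.Injective f) (χ : A →+ UnitAddCircle) :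
    ∃ ψ : B →+ UnitAddCircle, ∀ a, ψ (f a) = χ a := by
  obtain ⟨ψ, hψ⟩ := (Module.Baer.of_divisible UnitAddCircle).extension_property_addMonoidHom f hf χ
  exact ⟨ψ, fun a => DFunLike.congr_fun hψ a⟩

/-- Characters of an abelian group separate points. -/
theorem exists_character_ne_zero {A : Type*} [AddCommGroup A] {a : A} (ha : a ≠ 0) :
    ∃ χ : A →+ UnitAddCircle, χ a ≠ 0 := by
  obtain ⟨c, hc⟩ := CharacterModule.exists_character_apply_ne_zero_of_ne_zero ha
  let j : AddCircle (1 : ℚ) →+ UnitAddCircle :=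
    QuotientAddGroup.map _ _ (Rat.castHom ℝ).toAddMonoidHom
      (by
        rw [AddSubgroup.zmultiples_le]
        exact AddSubgroup.mem_comap.2 (by simp))
  have hj : Function.Injective j := by
    rw [injective_iff_map_eq_zero]
    intro x hx
    induction x using QuotientAddGroup.induction_on with
    | H q =>
      change ((q : ℝ) : UnitAddCircle) = 0 at hx
      rw [AddCircle.coe_eq_zero_iff] at hx
      obtain ⟨n, hn⟩ := hx
      rw [← QuotientAddGroup.mk_zero]
      refine (AddCircle.coe_eq_zero_iff (1 : ℚ)).2 ⟨n, ?_⟩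
      simp only [zsmul_eq_mul, mul_one] at hn ⊢
      exact_mod_cast hn
  let c' : A →+ AddCircle (1 : ℚ) := c
  exact ⟨j.comp c', fun h => hc (hj (h.trans j.map_zero.symm))⟩

/-! ### Precompact group topologies -/

section Precompact

variable {A B : Type*} [AddCommGroup A] [AddCommGroup B]

theorem exists_nhds_zero_sub_mem [TopologicalSpace A] [IsTopologicalAddGroup A] {U : Set A}
    (hU : U ∈ 𝓝 0) : ∃ V ∈ 𝓝 (0 : A), ∀ v ∈ V, ∀ w ∈ V, v - w ∈ U := by
  have h : Tendsto (fun p : A × A => p.1 - p.2) (𝓝 0 ×ˢ 𝓝 0) (𝓝 0) := by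
    rw [← nhds_prod_eq]
    simpa using (continuous_sub (G := A)).tendsto (0, 0)
  obtain ⟨V, hV, h⟩ := mem_prod_same_iff.1 (h hU)
  exact ⟨V, hV, fun v hv w hw => h (Set.mk_mem_prod hv hw)⟩

theorem IsPrecompactGroupTopology.of_compactSpace [TopologicalSpace A] [IsTopologicalAddGroup A]
    [CompactSpace A] [T2Space A] :
    IsPrecompactGroupTopology (inferInstance : TopologicalSpace A) where
  isTopologicalAddGroup := inferInstance
  t2Space := inferInstance
  exists_finite_add_eq_univ U hU := by
    obtain ⟨t, ht⟩ := compact_covered_by_add_left_translates (K := (Set.univ : Set A)) isCompact_univ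
      (V := U) ⟨0, mem_interior_iff_mem_nhds.2 hU⟩
    refine ⟨(fun a => -a) '' t, t.finite_toSet.image _, Set.eq_univ_of_forall fun x => ?_⟩
    obtain ⟨g, hg, hx⟩ := Set.mem_iUnion₂.1 (ht (Set.mem_univ x))
    exact Set.mem_add.2 ⟨-g, ⟨g, hg, rfl⟩, g + x, hx, by abel⟩

theorem IsPrecompactGroupTopology.prod {τ : TopologicalSpace A} {σ : TopologicalSpace B}
    (hτ : IsPrecompactGroupTopology τ) (hσ : IsPrecompactGroupTopology σ) :
    IsPrecompactGroupTopology (inferInstance : TopologicalSpace (A × B)) := by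
  have := hτ.1; have := hτ.2; have := hσ.1; have := hσ.2
  refine ⟨inferInstance, inferInstance, fun U hU => ?_⟩
  rw [Prod.zero_eq_mk, nhds_prod_eq] at hU
  obtain ⟨V, hV, W, hW, hVW⟩ := mem_prod_iff.1 hU
  obtain ⟨F, hF, hFV⟩ := hτ.3 V hV
  obtain ⟨F', hF', hFW⟩ := hσ.3 W hW
  refine ⟨F ×ˢ F', hF.prod hF', Set.eq_univ_of_forall fun x => ?_⟩
  obtain ⟨a, ha, v, hv, h1⟩ := Set.mem_add.1 (hFV.symm ▸ Set.mem_univ x.1)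
  obtain ⟨b, hb, w, hw, h2⟩ := Set.mem_add.1 (hFW.symm ▸ Set.mem_univ x.2)
  exact Set.mem_add.2 ⟨(a, b), ⟨ha, hb⟩, (v, w), hVW ⟨hv, hw⟩, Prod.ext h1 h2⟩

theorem IsPrecompactGroupTopology.induced {σ : TopologicalSpace B}
    (hσ : IsPrecompactGroupTopology σ) (f : A →+ B) (hf : Function.Injective f) :
    IsPrecompactGroupTopology (σ.induced f) := by
  have := hσ.1; have := hσ.2
  let _ : TopologicalSpace A := σ.induced f
  have hfi : IsInducing f := ⟨rfl⟩
  refine ⟨topologicalAddGroup_induced f, (IsEmbedding.mk hfi hf).t2Space, fun U hU => ?_⟩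
  rw [hfi.nhds_eq_comap, map_zero] at hU
  obtain ⟨V, hV, hVU⟩ := mem_comap.1 hU
  obtain ⟨W, hW, hWV⟩ := exists_nhds_zero_sub_mem hV
  obtain ⟨F, hF, hFW⟩ := hσ.3 W hW
  -- The finitely many centres lie in `B`; each is replaced by a point of `A` whose image lies in
  -- its translate, if there is one.
  have : ∀ b : B, ∃ a : A, ∀ a', f a' - b ∈ W → f a - b ∈ W := by
    intro b
    by_cases h : ∃ a, f a - b ∈ W
    · exact h.imp fun a ha _ _ => ha
    · exact ⟨0, fun a' ha' => (h ⟨a', ha'⟩).elim⟩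
  choose g hg using this
  refine ⟨g '' F, hF.image g, Set.eq_univ_of_forall fun x => ?_⟩
  obtain ⟨b, hb, w, hw, hx⟩ := Set.mem_add.1 (hFW.symm ▸ Set.mem_univ (f x))
  have hxb : f x - b ∈ W := by rwa [← hx, add_sub_cancel_left]
  refine Set.mem_add.2 ⟨g b, ⟨b, hb, rfl⟩, x - g b, hVU ?_, add_sub_cancel _ _⟩
  have := hWV _ hxb _ (hg b x hxb)
  rwa [sub_sub_sub_cancel_right, ← map_sub] at this

/-- This is the topology induced from `A × B` by the graph of `f`. -/
theorem IsPrecompactGroupTopology.inf_induced {τ : TopologicalSpace A} {σ : TopologicalSpace B}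
    (hτ : IsPrecompactGroupTopology τ) (hσ : IsPrecompactGroupTopology σ) (f : A →+ B) :
    IsPrecompactGroupTopology (τ ⊓ σ.induced f) := by
  have h := (hτ.prod hσ).induced ((AddMonoidHom.id A).prod f)
    fun a b (hab : (a, f a) = (b, f b)) => congrArg Prod.fst hab
  convert h using 1
  change _ = TopologicalSpace.induced _ (TopologicalSpace.induced _ _ ⊓ TopologicalSpace.induced _ _)
  rw [induced_inf, induced_compose, induced_compose]
  exact congrArg (· ⊓ _) induced_id.symm

theorem IsPrecompactGroupTopology.inf {τ σ : TopologicalSpace A}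
    (hτ : IsPrecompactGroupTopology τ) (hσ : IsPrecompactGroupTopology σ) :
    IsPrecompactGroupTopology (τ ⊓ σ) := by
  have h := hτ.inf_induced hσ (AddMonoidHom.id A)
  convert h using 2
  exact induced_id.symm

theorem IsPrecompactGroupTopology.quotient {τ : TopologicalSpace A}
    (hτ : IsPrecompactGroupTopology τ) (H : AddSubgroup A) (hH : IsClosed (H : Set A)) :
    IsPrecompactGroupTopology (inferInstance : TopologicalSpace (A ⧸ H)) := by
  have := hτ.1; have := hτ.2
  refine ⟨inferInstance, ?_, fun U hU => ?_⟩
  · have : T3Space (A ⧸ H) := inferInstance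
    infer_instance
  · obtain ⟨F, hF, hFU⟩ := hτ.3 (QuotientAddGroup.mk ⁻¹' U)
      (continuous_quot_mk.continuousAt.preimage_mem_nhds hU)
    refine ⟨QuotientAddGroup.mk '' F, hF.image _, Set.eq_univ_of_forall fun x => ?_⟩
    obtain ⟨x, rfl⟩ := QuotientAddGroup.mk_surjective x
    obtain ⟨a, ha, v, hv, hx⟩ := Set.mem_add.1 (hFU.symm ▸ Set.mem_univ x)
    exact Set.mem_add.2 ⟨a, ⟨a, ha, rfl⟩, v, hv, by rw [← hx]; rfl⟩

/-- A precompact group topology is the weak topology of its continuous characters. -/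
theorem IsPrecompactGroupTopology.isInducing_characters {σ : TopologicalSpace A}
    (hσ : IsPrecompactGroupTopology σ) :
    IsInducing fun (x : A) (χ : {χ : A →+ UnitAddCircle // Continuous χ}) => χ.1 x := by
  have := hσ.1; have := hσ.2
  let u : UniformSpace A := IsTopologicalAddGroup.rightUniformSpace A
  have : IsUniformAddGroup A := isUniformAddGroup_of_addCommGroup
  have htb : TotallyBounded (Set.univ : Set A) := by
    rw [totallyBounded_iff_subset_finite_iUnion_nhds_zero]
    intro U hU
    obtain ⟨F, hF, hFU⟩ := hσ.3 U hU
    refine ⟨F, hF, fun x _ => ?_⟩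
    obtain ⟨a, ha, v, hv, hx⟩ := Set.mem_add.1 (hFU.symm ▸ Set.mem_univ x)
    exact Set.mem_iUnion₂.2 ⟨a, ha, v, hv, hx⟩
  let K := UniformSpace.Completion A
  have : CompactSpace K := by
    have h1 := (htb.image (UniformSpace.Completion.uniformContinuous_coe A)).closure
    rw [Set.image_univ, UniformSpace.Completion.denseRange_coe.closure_range] at h1
    exact ⟨h1.isCompact_of_isClosed isClosed_univ⟩
  let Φ : K → ({χ : K →+ UnitAddCircle // Continuous χ} → UnitAddCircle) := fun x χ => χ.1 x
  have hΦ : IsInducing Φ := by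
    refine (Continuous.isClosedEmbedding (continuous_pi fun χ => χ.2) fun x y hxy => ?_).isInducing
    by_contra hne
    obtain ⟨χ, hχ, hχ'⟩ := exists_continuous_character_ne_zero (sub_ne_zero.2 hne)
    exact hχ' (by rw [map_sub, sub_eq_zero]; exact congrFun hxy ⟨χ, hχ⟩)
  have hι : IsInducing ((↑) : A → K) := (UniformSpace.Completion.isUniformInducing_coe A).isInducing
  -- Characters of the completion restrict to `A`, so its embedding in a torus factors through the
  -- characters of `A`.
  let r : ({χ : A →+ UnitAddCircle // Continuous χ} → UnitAddCircle) →
      ({χ : K →+ UnitAddCircle // Continuous χ} → UnitAddCircle) :=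
    fun y χ => y ⟨χ.1.comp UniformSpace.Completion.toCompl,
      χ.2.comp (UniformSpace.Completion.continuous_coe A)⟩
  have hr : Continuous r := continuous_pi fun χ => continuous_apply _
  exact IsInducing.of_comp (continuous_pi fun χ => χ.2) hr (hΦ.comp hι)

/-- A precompact group topology is coarser than any topology for which its continuous characters
are continuous. -/
theorem IsPrecompactGroupTopology.le_of_continuous_characters {σ : TopologicalSpace A}
    (hσ : IsPrecompactGroupTopology σ) (ρ : TopologicalSpace A)
    (h : ∀ χ : A →+ UnitAddCircle, Continuous[σ, _] χ → Continuous[ρ, _] χ) : ρ ≤ σ := by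
  have hσi := @IsInducing.eq_induced _ _ σ _ _ hσ.isInducing_characters
  refine le_of_le_of_eq ?_ hσi.symm
  rw [← continuous_iff_le_induced]
  exact @continuous_pi _ _ _ ρ _ _ fun χ => h χ.1 χ.2

/-- **Merson's lemma**: comparable group topologies that agree on a subgroup and on the quotient
by it are equal. -/
theorem le_of_induced_le_of_coinduced_le {τ ρ : TopologicalSpace A}
    (hτ : @IsTopologicalAddGroup A τ _) (hρ : @IsTopologicalAddGroup A ρ _) (hle : ρ ≤ τ)
    (H : AddSubgroup A) (hH : τ.induced ((↑) : H → A) ≤ ρ.induced ((↑) : H → A))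
    (hQ : τ.coinduced (QuotientAddGroup.mk : A → A ⧸ H) ≤
      ρ.coinduced (QuotientAddGroup.mk : A → A ⧸ H)) : τ ≤ ρ := by
  have hn : @nhds A τ 0 ≤ @nhds A ρ 0 := by
    intro U hU
    obtain ⟨V, hV, hVU⟩ := @exists_nhds_zero_sub_mem A _ ρ hρ U hU
    obtain ⟨O, hO, hOV⟩ : ∃ O ∈ @nhds A τ 0, ((↑) : H → A) ⁻¹' O ⊆ (↑) ⁻¹' V := by
      have h : ((↑) : H → A) ⁻¹' V ∈ @nhds H (τ.induced (↑)) 0 := by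
        refine nhds_mono hH ?_
        rw [@nhds_induced _ _ ρ]
        exact preimage_mem_comap hV
      rw [@nhds_induced _ _ τ] at h
      exact h
    obtain ⟨W, hW, hWO⟩ := @exists_nhds_zero_sub_mem A _ τ hτ O hO
    have hVW : V ∩ W ∈ @nhds A ρ 0 := inter_mem hV (nhds_mono hle hW)
    have hN : (QuotientAddGroup.mk : A → A ⧸ H) '' (V ∩ W) ∈ @nhds (A ⧸ H) (ρ.coinduced (↑)) 0 := by
      let _ := ρ
      exact QuotientAddGroup.isOpenMap_coe.image_mem_nhds hVW
    have hN' : (QuotientAddGroup.mk : A → A ⧸ H) ⁻¹' ((↑) '' (V ∩ W)) ∈ @nhds A τ 0 := by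
      let _ := τ
      exact (continuous_coinduced_rng (f := (QuotientAddGroup.mk : A → A ⧸ H))).continuousAt
        (nhds_mono hQ hN)
    refine mem_of_superset (inter_mem hW hN') ?_
    -- Here `v - w` lies in `O` and in `H`, hence in `V`, so `w = v - (v - w)` lies in `U`.
    rintro w ⟨hw, v, ⟨hvV, hvW⟩, hvw⟩
    have hH' : v - w ∈ H := by
      rw [← neg_mem_iff, neg_sub, sub_eq_neg_add]
      exact QuotientAddGroup.eq.1 hvw
    have := hVU v hvV (v - w) (hOV (a := ⟨v - w, hH'⟩) (hWO v hvW w hw))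
    rwa [sub_sub_cancel] at this
  refine le_of_nhds_le_nhds fun a => ?_
  rw [← @map_add_left_nhds_zero A τ _ _ a, ← @map_add_left_nhds_zero A ρ _ _ a]
  exact map_mono hn

end Precompact

/-! ### Characterizing sequences and B-embedded subgroups -/

section Characterized

variable {G : Type*} [AddCommGroup G]

/-- Characters which tend to zero along a characterizing sequence are continuous. -/
theorem Characterizes.continuous_character {τ : TopologicalSpace G} {u : ℕ → G}
    (hu : Characterizes u τ) (χ : G →+ UnitAddCircle)
    (hχ : Tendsto (fun n => χ (u n)) atTop (𝓝 0)) : Continuous χ := by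
  refine continuous_iff_le_induced.2 ((hu.2 ⟨hu.1.1.inf_induced .of_compactSpace χ, ?_⟩).trans
    inf_le_right)
  unfold TendsToZero
  rw [@nhds_inf, @nhds_induced, tendsto_inf, tendsto_comap_iff, map_zero]
  exact ⟨hu.1.2, hχ⟩

theorem IsPrecompactGroupTopology.subtype {τ : TopologicalSpace G}
    (hτ : IsPrecompactGroupTopology τ) (H : AddSubgroup G) :
    IsPrecompactGroupTopology (instTopologicalSpaceSubtype : TopologicalSpace H) :=
  hτ.induced H.subtype Subtype.val_injective

theorem Characterizes.isBEmbedded {τ : TopologicalSpace G} {u : ℕ → G}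
    (hu : Characterizes u τ) (H : AddSubgroup G) (hH : ∀ n, u n ∈ H) : IsBEmbedded H := by
  intro χ
  refine isQuotientMap_quotient_mk'.continuous_iff.2 ?_
  refine hu.continuous_character (χ.comp (QuotientAddGroup.mk' H)) ?_
  have : ∀ n, (χ.comp (QuotientAddGroup.mk' H)) (u n) = 0 := by
    intro n
    have h : QuotientAddGroup.mk' H (u n) = 0 := (QuotientAddGroup.eq_zero_iff _).2 (hH n)
    rw [AddMonoidHom.comp_apply, h, map_zero]
  simp only [this]
  exact tendsto_const_nhds

theorem Characterizes.isSSCharacterized_subtype {τ : TopologicalSpace G} {u : ℕ → G}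
    (hu : Characterizes u τ) (H : AddSubgroup G) (hH : ∀ n, u n ∈ H) :
    IsSSCharacterized (instTopologicalSpaceSubtype : TopologicalSpace H) := by
  refine ⟨fun n => ⟨u n, hH n⟩, ⟨hu.1.1.subtype H, tendsto_subtype_rng.2 hu.1.2⟩, ?_⟩
  have key : ∀ ψ : G →+ UnitAddCircle, Tendsto (fun n => ψ (u n)) atTop (𝓝 0) →
      Continuous fun h : H => ψ h :=
    fun ψ hψ => (hu.continuous_character ψ hψ).comp continuous_subtype_val
  rintro σ ⟨hσ, hσu⟩
  refine hσ.le_of_continuous_characters _ fun χ hχ => ?_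
  obtain ⟨ψ, hψ⟩ := exists_character_extension H.subtype Subtype.val_injective χ
  rw [show ⇑χ = fun h : H => ψ h from funext fun h => (hψ h).symm]
  refine key ψ ?_
  have h := (hχ.tendsto 0).comp hσu
  rw [map_zero] at h
  exact h.congr fun n => (hψ ⟨u n, hH n⟩).symm

/-- Characters of `G ⧸ H` separate points and are all continuous, so `H` is an intersection of
closed kernels. This makes the quotient Hausdorff. -/
theorem IsBEmbedded.isClosed [TopologicalSpace G] {H : AddSubgroup G} (hH : IsBEmbedded H) :
    IsClosed (H : Set G) := by
  have : (H : Set G) = ⋂ χ : G ⧸ H →+ UnitAddCircle, {x : G | χ x = 0} := by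
    ext x
    simp only [SetLike.mem_coe, Set.mem_iInter, Set.mem_ofPred_eq]
    rw [← QuotientAddGroup.eq_zero_iff]
    refine ⟨fun h χ => by rw [h, map_zero], fun h => ?_⟩
    by_contra hx
    obtain ⟨χ, hχ⟩ := exists_character_ne_zero hx
    exact hχ (h χ)
  rw [this]
  exact isClosed_iInter fun χ =>
    isClosed_singleton.preimage ((hH χ).comp QuotientAddGroup.continuous_mk)

/-- A sequence characterizing the topology of a B-embedded subgroup also characterizes the topology
of the whole group. -/
theorem IsBEmbedded.isSSCharacterized {τ : TopologicalSpace G} (hτ : IsPrecompactGroupTopology τ)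
    {H : AddSubgroup G} (hH : IsBEmbedded H)
    (hs : IsSSCharacterized (instTopologicalSpaceSubtype : TopologicalSpace H)) :
    IsSSCharacterized τ := by
  obtain ⟨u, hu⟩ := hs
  have hu0 : TendsToZero τ fun n => (u n : G) := tendsto_subtype_rng.1 hu.1.2
  refine ⟨fun n => u n, ⟨hτ, hu0⟩, ?_⟩
  have hcl : IsClosed (H : Set G) := hH.isClosed
  rintro σ ⟨hσ, hσu⟩
  have hρ := hτ.inf hσ
  refine le_trans ?_ (inf_le_right : τ ⊓ σ ≤ σ)
  refine le_of_induced_le_of_coinduced_le hτ.1 hρ.1 inf_le_left H ?_ ?_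
  · refine hu.2 ⟨hρ.induced H.subtype Subtype.val_injective, ?_⟩
    unfold TendsToZero
    rw [@nhds_induced, tendsto_comap_iff]
    change Tendsto _ _ (@nhds G (τ ⊓ σ) 0)
    rw [@nhds_inf _ τ σ, tendsto_inf]
    exact ⟨hu0, hσu⟩
  -- A precompact topology on `G ⧸ H` is coarser than any topology making every character
  -- continuous.
  · exact (hρ.quotient H (hcl.mono inf_le_left)).le_of_continuous_characters _ fun χ _ => hH χ

end Characterized

theorem theoremC {G : Type*} [AddCommGroup G] [τ : TopologicalSpace G]
    (hτ : IsPrecompactGroupTopology τ) :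
    IsSSCharacterized τ ↔
      ∃ H : AddSubgroup G, Countable H ∧ IsBEmbedded H ∧
        IsSSCharacterized (instTopologicalSpaceSubtype : TopologicalSpace H) := by
  constructor
  · rintro ⟨u, hu⟩
    -- The range is the subgroup generated by `u`, countable because `ℕ →₀ ℤ` is.
    let f : (ℕ →₀ ℤ) →+ G := (Finsupp.linearCombination ℤ u).toAddMonoidHom
    have hf : ∀ n, u n ∈ f.range := fun n => ⟨Finsupp.single n 1, by simp [f]⟩
    exact ⟨f.range, (Set.countable_range f).to_subtype, hu.isBEmbedded _ hf,
      hu.isSSCharacterized_subtype _ hf⟩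
  · rintro ⟨H, -, hB, hs⟩
    exact hB.isSSCharacterized hτ hs
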